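/- Let $N\ge 1$, $k\in\mathbb{N}$, and let $\mathbf{u}=(u_1,\dots,u_k)$, $u_i\in C^2(\mathbb{R}^N)$, be a nonnegative solution of $$-\Delta u_i=-\sum_{j\ne i}u_j^2u_i\quad\text{in }\mathbb{R}^N,\qquad i=1,\dots,k,$$ that is, $u_i\ge 0$ for every $i$ and at least two of the components are not identically zero. Assume that $\mathbf{u}$ has algebraic growth: there are $C,p>0$ such that $u_1(x)+\cdots+u_k(x)\le C(1+|x|^p)$ for every $x\in\mathbb{R}^N$. For $r>0$ set $$H(\mathbf{u},0,r)=\frac1{r^{N-1}}\int_{\partial B_r}\sum_{i=1}^k u_i^2,\qquad E(\mathbf{u},0,r)=\frac1{r^{N-2}}\int_{B_r}\Big(\sum_{i=1}^k|\nabla u_i|^2+\sum_{1\le i<j\le k}u_i^2u_j^2\Big),\qquad N(\mathbf{u},0,r)=\frac{E(\mathbf{u},0,r)}{H(\mathbf{u},0,r)},$$ where $B_r$ is the ball of centre $0$ and radius $r$ in $\mathbb{R}^N$. Then the limit $d:=N(\mathbf{u},0,+\infty)=\lim_{r\to+\infty}N(\mathbf{u},0,r)$ exists, $d\in(0,+\infty)$,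 and $d$ is the growth rate of $\mathbf{u}$: for every $d'\in\mathbb{R}$, $$\lim_{r\to+\infty}\frac{H(\mathbf{u},0,r)}{r^{2d'}}=\begin{cases}+\infty&\text{if }d'<d,\\0&\text{if }d'>d.\end{cases}$$ -/

import Mathlib

open MeasureTheory Filter Topology

/-- `ℝᴺ` with its Euclidean norm. -/
abbrev RSpace (N : ℕ) : Type := EuclideanSpace ℝ (Fin N)

/-- A nonnegative (entire, classical) solution `u = (u₁, …, u_k)` of the competitive system
`-Δ uᵢ = -∑_{j ≠ i} uⱼ² uᵢ` in `ℝᴺ`: every component is nonnegative, and at least two components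
are not identically zero. -/
structure IsNonnegSolution {N k : ℕ} (u : Fin k → RSpace N → ℝ) : Prop where
  contDiff : ∀ i, ContDiff ℝ 2 (u i)
  equation : ∀ i x,
    -(Laplacian.laplacian (u i) x) = -∑ j ∈ Finset.univ.filter (fun j => j ≠ i), u j x ^ 2 * u i x
  nonneg : ∀ i x, 0 ≤ u i x
  two_nontrivial : ∃ i j, i ≠ j ∧ (∃ x, u i x ≠ 0) ∧ (∃ x, u j x ≠ 0)

/-- Algebraic growth: `u₁(x) + ⋯ + u_k(x) ≤ C (1 + |x|^p)` in `ℝᴺ` for some `C, p > 0`. -/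
def HasAlgebraicGrowth {N k : ℕ} (u : Fin k → RSpace N → ℝ) : Prop :=
  ∃ C p : ℝ, 0 < C ∧ 0 < p ∧ ∀ x, ∑ i, u i x ≤ C * (1 + ‖x‖ ^ p)

/-- The surface measure of the sphere `∂B_r(x₀)`, `r > 0`, as a measure on `ℝᴺ`: the image of the
surface measure `volume.toSphere` of the unit sphere under `ω ↦ x₀ + r ω`, times `r ^ (N - 1)`. -/
noncomputable def sphereMeasure {N : ℕ} (x₀ : RSpace N) (r : ℝ) : Measure (RSpace N) :=
  ENNReal.ofReal (r ^ ((N : ℤ) - 1)) •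
    ((volume : Measure (RSpace N)).toSphere.map
      (fun ω : Metric.sphere (0 : RSpace N) 1 => x₀ + r • (ω : RSpace N)))

/-- `H(u, x₀, r) = r^{-(N-1)} ∫_{∂B_r(x₀)} ∑ᵢ uᵢ²`. -/
noncomputable def almgrenH {N k : ℕ} (u : Fin k → RSpace N → ℝ) (x₀ : RSpace N) (r : ℝ) : ℝ :=
  1 / r ^ ((N : ℤ) - 1) * ∫ x, ∑ i, u i x ^ 2 ∂(sphereMeasure x₀ r)

/-- `E(u, x₀, r) = r^{-(N-2)} ∫_{B_r(x₀)} (∑ᵢ |∇uᵢ|² + ∑_{i<j} uᵢ² uⱼ²)`. -/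
noncomputable def almgrenE {N k : ℕ} (u : Fin k → RSpace N → ℝ) (x₀ : RSpace N) (r : ℝ) : ℝ :=
  1 / r ^ ((N : ℤ) - 2) *
    ∫ x in Metric.ball x₀ r,
      (∑ i, ‖gradient (u i) x‖ ^ 2 + ∑ i, ∑ j ∈ Finset.Ioi i, u i x ^ 2 * u j x ^ 2)

/-- The Almgren frequency function `N(u, x₀, r) = E(u, x₀, r) / H(u, x₀, r)`. -/
noncomputable def almgrenFrequency {N k : ℕ} (u : Fin k → RSpace N → ℝ) (x₀ : RSpace N) (r : ℝ) :
    ℝ :=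
  almgrenE u x₀ r / almgrenH u x₀ r

/-- `u` has growth rate `d`: as `r → +∞`, `H(u, 0, r) / r^{2d'}` tends to `+∞` for every `d' < d`
and to `0` for every `d' > d`. -/
def HasGrowthRate {N k : ℕ} (u : Fin k → RSpace N → ℝ) (d : ℝ) : Prop :=
  (∀ d' : ℝ, d' < d → Tendsto (fun r : ℝ => almgrenH u 0 r / r ^ (2 * d')) atTop atTop) ∧
  (∀ d' : ℝ, d < d' → Tendsto (fun r : ℝ => almgrenH u 0 r / r ^ (2 * d')) atTop (𝓝 0))

/-!
# The Almgren frequency of entire solutions of a competitive system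

Write `e = ∑ᵢ |∇uᵢ|² + W` with `W = ∑_{i < j} uᵢ² uⱼ²`, so that the system reads `Δ uᵢ = ½ ∂W/∂uᵢ`.
Applying the divergence theorem on `B_r` to the fields `∑ᵢ uᵢ ∇uᵢ` and `e x - 2 ∑ᵢ ⟪x, ∇uᵢ⟫ ∇uᵢ`
(the latter is the Pohozaev identity) gives, with `ω(r) = r^{2-N} ∫_{B_r} W`,
`B(r) = r^{1-N} ∫_{∂B_r} ∑ᵢ uᵢ ∂_ν uᵢ` and `Q(r) = r^{1-N} ∫_{∂B_r} ∑ᵢ (∂_ν uᵢ)²`,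

* `H' = 2 B`, `r B = E + ω` (`hasDerivAt_almgrenH`, `mul_radialFlux_eq`);
* `E' = 2 ω / r + 2 r Q` (`hasDerivAt_almgrenE`).

By Cauchy-Schwarz `B² ≤ H Q`, and hence the frequency `n = E / H` satisfies `n' ≥ 2 ω / (r H) ≥ 0`
(`FrequencySystem.frequency_deriv`). Since `(log H)' = 2 n / r + 2 ω / (r H)`, two bounds follow.
From below, `H ≥ c r^{2 n(r₁)}` beyond any radius `r₁`; with the algebraic growth of the solution
this bounds the increasing function `n`, so that `n` has a finite limit `d`. From above,
`log H - n - 2 d log r` is nonincreasing, so that `H ≤ c r^{2 d}`. Together they identify `d` as the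
growth rate. The limit is positive since two nontrivial components cannot both be constant.

The divergence theorem on balls (`mul_integral_ball_divergence`) is obtained from integration by
parts on the whole space against compactly supported radial functions and from polar coordinates:
these show that the two sides agree as distributions in the radius, and both are continuous.
-/

/-! ### Monotonicity of the frequency from its differential relations -/

/-- The differential relations behind an Almgren-type frequency `E / H` on a half-line `[r₀, ∞)`
on which the height `H` is positive. Here `E` is the scaled energy, `B` half the derivative of the
height, `Q` the height of the radial derivative and `ω` the scaled interaction energy. -/
structure FrequencySystem (H E B Q ω : ℝ → ℝ) (r₀ : ℝ) : Prop where
  radius_pos : 0 < r₀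
  height_deriv : ∀ r, 0 < r → HasDerivAt H (2 * B r) r
  energy_deriv : ∀ r, 0 < r → HasDerivAt E (2 * ω r / r + 2 * r * Q r) r
  flux_eq : ∀ r, 0 < r → r * B r = E r + ω r
  cauchy_schwarz : ∀ r, 0 < r → B r ^ 2 ≤ H r * Q r
  interaction_nonneg : ∀ r, 0 < r → 0 ≤ ω r
  energy_nonneg : ∀ r, 0 < r → 0 ≤ E r
  height_pos : ∀ r, r₀ ≤ r → 0 < H r

namespace FrequencySystem

variable {H E B Q ω : ℝ → ℝ} {r₀ : ℝ}

lemma pos_of_le (S : FrequencySystem H E B Q ω r₀) {r : ℝ} (hr : r₀ ≤ r) : 0 < r :=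
  S.radius_pos.trans_le hr

lemma flux_div_height (S : FrequencySystem H E B Q ω r₀) {r : ℝ} (hr : r₀ ≤ r) :
    2 * B r / H r = 2 * (E r / H r) / r + 2 * ω r / (r * H r) := by
  have hr0 := S.pos_of_le hr
  have hH := S.height_pos r hr
  field_simp
  linarith [S.flux_eq r hr0]

/-- The interaction term, which spoils the equality `r H' = 2 E`, is controlled by the derivative
of the frequency. -/
lemma frequency_deriv (S : FrequencySystem H E B Q ω r₀) {r : ℝ} (hr : r₀ ≤ r) :
    ∃ n', HasDerivAt (fun r => E r / H r) n' r ∧ 2 * ω r / (r * H r) ≤ n' := by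
  have hr0 := S.pos_of_le hr
  have hH := S.height_pos r hr
  refine ⟨_, (S.energy_deriv r hr0).div (S.height_deriv r hr0) hH.ne', ?_⟩
  have hfl := S.flux_eq r hr0
  have hE : E r = r * B r - ω r := by linarith
  have hω := S.interaction_nonneg r hr0
  have hB : 0 ≤ B r := by
    have := S.energy_nonneg r hr0
    nlinarith
  have hCS := S.cauchy_schwarz r hr0
  rw [hE, ← sub_nonneg]
  have : ((2 * ω r / r + 2 * r * Q r) * H r - (r * B r - ω r) * (2 * B r)) / H r ^ 2
      - 2 * ω r / (r * H r)
      = (2 * r * (H r * Q r - B r ^ 2) + 2 * (ω r * B r)) / H r ^ 2 := by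
    field_simp
    ring
  rw [this]
  have h1 : 0 ≤ H r * Q r - B r ^ 2 := sub_nonneg.2 hCS
  positivity

lemma interaction_div_nonneg (S : FrequencySystem H E B Q ω r₀) {r : ℝ} (hr : r₀ ≤ r) :
    0 ≤ 2 * ω r / (r * H r) := by
  have hr0 := S.pos_of_le hr
  have hH := S.height_pos r hr
  have := S.interaction_nonneg r hr0
  positivity

lemma frequency_monotoneOn (S : FrequencySystem H E B Q ω r₀) :
    MonotoneOn (fun r => E r / H r) (Set.Ici r₀) := by
  refine monotoneOn_of_deriv_nonneg (convex_Ici _) (fun r hr => ?_) (fun r hr => ?_)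
    (fun r hr => ?_)
  · obtain ⟨n', h, -⟩ := S.frequency_deriv hr
    exact h.continuousAt.continuousWithinAt
  · obtain ⟨n', h, -⟩ := S.frequency_deriv (interior_subset hr)
    exact h.differentiableAt.differentiableWithinAt
  · obtain ⟨n', h, h'⟩ := S.frequency_deriv (interior_subset hr)
    rw [h.deriv]
    exact (S.interaction_div_nonneg (interior_subset hr)).trans h'

lemma log_height_deriv (S : FrequencySystem H E B Q ω r₀) {r : ℝ} (hr : r₀ ≤ r) (a : ℝ) :
    HasDerivAt (fun r => Real.log (H r) - 2 * a * Real.log r)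
      (2 * (E r / H r) / r + 2 * ω r / (r * H r) - 2 * a / r) r := by
  have hr0 := S.pos_of_le hr
  have hH := S.height_pos r hr
  have h := ((S.height_deriv r hr0).log hH.ne').sub
    ((Real.hasDerivAt_log hr0.ne').const_mul (2 * a))
  rw [S.flux_div_height hr] at h
  exact h

/-- The height grows at least like `r ^ (2 N(r₁))` beyond every radius `r₁`. -/
lemma height_lower (S : FrequencySystem H E B Q ω r₀) {r₁ : ℝ} (h₁ : r₀ ≤ r₁) :
    ∃ c, 0 < c ∧ ∀ r, r₁ ≤ r → c * r ^ (2 * (E r₁ / H r₁)) ≤ H r := by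
  set a := E r₁ / H r₁ with ha
  have hr1 := S.pos_of_le h₁
  have hmono : MonotoneOn (fun r => Real.log (H r) - 2 * a * Real.log r) (Set.Ici r₁) := by
    refine monotoneOn_of_deriv_nonneg (convex_Ici _) (fun r hr => ?_) (fun r hr => ?_)
      (fun r hr => ?_)
    · exact (S.log_height_deriv (h₁.trans hr) a).continuousAt.continuousWithinAt
    · exact (S.log_height_deriv (h₁.trans (interior_subset hr)) a
        ).differentiableAt.differentiableWithinAt
    · have hr' : r₁ ≤ r := interior_subset hr
      rw [(S.log_height_deriv (h₁.trans hr') a).deriv]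
      have h2 : a ≤ E r / H r := S.frequency_monotoneOn h₁ (h₁.trans hr') hr'
      have h3 := S.interaction_div_nonneg (h₁.trans hr')
      have h4 : 2 * a / r ≤ 2 * (E r / H r) / r := by
        have := S.pos_of_le (h₁.trans hr')
        gcongr
      linarith
  refine ⟨Real.exp (Real.log (H r₁) - 2 * a * Real.log r₁), Real.exp_pos _, fun r hr => ?_⟩
  have hr0 := S.pos_of_le (h₁.trans hr)
  have h := hmono (Set.mem_Ici.2 le_rfl) (Set.mem_Ici.2 hr) hr
  simp only at h
  rw [Real.rpow_def_of_pos hr0, ← Real.exp_add, ← Real.le_log_iff_exp_le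
    (S.height_pos r (h₁.trans hr))]
  linarith

/-- The height grows at most like `r ^ (2 d)` when the frequency stays below `d`: the function
`log H - N - 2 d log r` is nonincreasing. -/
lemma height_upper (S : FrequencySystem H E B Q ω r₀) {d : ℝ}
    (hd : ∀ r, r₀ ≤ r → E r / H r ≤ d) :
    ∃ c, ∀ r, r₀ ≤ r → H r ≤ c * r ^ (2 * d) := by
  have hanti : AntitoneOn (fun r => (Real.log (H r) - 2 * d * Real.log r) - E r / H r)
      (Set.Ici r₀) := by
    refine antitoneOn_of_deriv_nonpos (convex_Ici _) (fun r hr => ?_) (fun r hr => ?_)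
      (fun r hr => ?_)
    · obtain ⟨n', h, -⟩ := S.frequency_deriv hr
      exact ((S.log_height_deriv hr d).sub h).continuousAt.continuousWithinAt
    · obtain ⟨n', h, -⟩ := S.frequency_deriv (interior_subset hr)
      exact ((S.log_height_deriv (interior_subset hr) d).sub
        h).differentiableAt.differentiableWithinAt
    · have hr' : r₀ ≤ r := interior_subset hr
      obtain ⟨n', h, h'⟩ := S.frequency_deriv hr'
      rw [((S.log_height_deriv hr' d).fun_sub h).deriv]
      have h4 : 2 * (E r / H r) / r ≤ 2 * d / r := by
        have := S.pos_of_le hr'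
        have := hd r hr'
        gcongr
      linarith
  refine ⟨Real.exp ((Real.log (H r₀) - 2 * d * Real.log r₀) - E r₀ / H r₀ + d), fun r hr => ?_⟩
  have hr0 := S.pos_of_le hr
  have h := hanti (Set.mem_Ici.2 le_rfl) (Set.mem_Ici.2 hr) hr
  simp only at h
  rw [Real.rpow_def_of_pos hr0, ← Real.exp_add, ← Real.log_le_iff_le_exp (S.height_pos r hr)]
  linarith [hd r hr]

/-- A polynomial bound on the height bounds the frequency. -/
lemma frequency_le (S : FrequencySystem H E B Q ω r₀) {M p : ℝ}
    (hM : ∀ r, 1 ≤ r → H r ≤ M * r ^ (2 * p)) {r₁ : ℝ} (h₁ : r₀ ≤ r₁) : E r₁ / H r₁ ≤ p := by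
  by_contra! hlt
  obtain ⟨c, hc, hlow⟩ := S.height_lower h₁
  have hlim : Tendsto (fun r : ℝ => c * r ^ (2 * (E r₁ / H r₁ - p))) atTop atTop :=
    (tendsto_rpow_atTop (by linarith)).const_mul_atTop hc
  obtain ⟨r, hr1, hrM, hr2⟩ := ((eventually_ge_atTop (max 1 r₁)).and
    ((hlim.eventually_gt_atTop M).and (eventually_gt_atTop 0))).exists
  have hle := (hlow r ((le_max_right _ _).trans hr1)).trans (hM r ((le_max_left _ _).trans hr1))
  have hsplit : r ^ (2 * (E r₁ / H r₁)) = r ^ (2 * (E r₁ / H r₁ - p)) * r ^ (2 * p) := by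
    rw [← Real.rpow_add hr2]; ring_nf
  rw [hsplit, ← mul_assoc] at hle
  exact absurd (le_of_mul_le_mul_right hle (Real.rpow_pos_of_pos hr2 _)) (not_le.2 hrM)

/-- If the height grows at most polynomially, the frequency has a limit at infinity, and this
limit is the growth rate of the height. -/
theorem exists_limit_and_growth (S : FrequencySystem H E B Q ω r₀) {M p : ℝ}
    (hM : ∀ r, 1 ≤ r → H r ≤ M * r ^ (2 * p)) (hE : ∃ r, r₀ ≤ r ∧ 0 < E r) :
    ∃ d : ℝ, Tendsto (fun r => E r / H r) atTop (𝓝 d) ∧ 0 < d ∧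
      (∀ d' : ℝ, d' < d → Tendsto (fun r : ℝ => H r / r ^ (2 * d')) atTop atTop) ∧
      (∀ d' : ℝ, d < d' → Tendsto (fun r : ℝ => H r / r ^ (2 * d')) atTop (𝓝 0)) := by
  set n : ℝ → ℝ := fun r => E r / H r with hn
  have hmono : Monotone fun r => n (max r₀ r) := fun r s hrs =>
    S.frequency_monotoneOn (Set.mem_Ici.2 (le_max_left _ _)) (Set.mem_Ici.2 (le_max_left _ _))
      (max_le_max le_rfl hrs)
  have hbdd : BddAbove (Set.range fun r => n (max r₀ r)) :=
    ⟨p, by rintro _ ⟨r, rfl⟩; exact S.frequency_le hM (le_max_left _ _)⟩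
  set d := ⨆ r, n (max r₀ r)
  have hle : ∀ r, r₀ ≤ r → n r ≤ d := fun r hr => by
    simpa only [max_eq_right hr] using le_ciSup hbdd r
  have hlim : Tendsto n atTop (𝓝 d) := by
    refine (tendsto_atTop_ciSup hmono hbdd).congr' ?_
    filter_upwards [eventually_ge_atTop r₀] with r hr
    rw [max_eq_right hr]
  refine ⟨d, hlim, ?_, fun d' hd' => ?_, fun d' hd' => ?_⟩
  · obtain ⟨r, hr, hEr⟩ := hE
    exact (div_pos hEr (S.height_pos r hr)).trans_le (hle r hr)
  · obtain ⟨r₁, hr₁, hd₁⟩ := ((eventually_ge_atTop r₀).and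
      (hlim.eventually (lt_mem_nhds hd'))).exists
    obtain ⟨c, hc, hlow⟩ := S.height_lower hr₁
    refine tendsto_atTop_mono' atTop ?_ ((tendsto_rpow_atTop
      (show 0 < 2 * (n r₁ - d') by linarith)).const_mul_atTop hc)
    filter_upwards [eventually_ge_atTop r₁] with r hr
    have hr0 := S.pos_of_le (hr₁.trans hr)
    rw [le_div_iff₀ (Real.rpow_pos_of_pos hr0 _), mul_assoc, ← Real.rpow_add hr0,
      show 2 * (n r₁ - d') + 2 * d' = 2 * n r₁ by ring]
    exact hlow r hr
  · obtain ⟨c, hup⟩ := S.height_upper hle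
    have hz : Tendsto (fun r : ℝ => c * r ^ (-(2 * (d' - d)))) atTop (𝓝 0) := by
      simpa using (tendsto_rpow_neg_atTop (show 0 < 2 * (d' - d) by linarith)).const_mul c
    refine squeeze_zero' ?_ ?_ hz
    · filter_upwards [eventually_ge_atTop r₀] with r hr
      exact div_nonneg (S.height_pos r hr).le (Real.rpow_nonneg (S.pos_of_le hr).le _)
    · filter_upwards [eventually_ge_atTop r₀] with r hr
      have hr0 := S.pos_of_le hr
      rw [div_le_iff₀ (Real.rpow_pos_of_pos hr0 _), mul_assoc, ← Real.rpow_add hr0,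
        show -(2 * (d' - d)) + 2 * d' = 2 * d by ring]
      exact hup r hr

end FrequencySystem

/-! ### Divergence and radial functions -/

section Divergence

variable {V : Type*} [NormedAddCommGroup V] [InnerProductSpace ℝ V]

/-- A radial function `η(|x|)` with `η' = t χ(t)` has derivative `χ(|x|) ⟪x, ·⟫`. The factor `t`
makes this hold at the origin too. -/
lemma hasFDerivAt_radial {η χ : ℝ → ℝ} (hη : ∀ t, HasDerivAt η (t * χ t) t) (x : V) :
    HasFDerivAt (fun x : V => η ‖x‖) (χ ‖x‖ • innerSL ℝ x) x := by
  rcases eq_or_ne x 0 with rfl | hx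
  · have h0 : HasDerivAt η 0 0 := by simpa using hη 0
    have h1 := (hasDerivAt_iff_isLittleO.1 h0).comp_tendsto
      (show Tendsto (fun y : V => ‖y‖) (𝓝 0) (𝓝 0) by simpa using tendsto_norm_zero (E := V))
    refine .of_isLittleO ?_
    have h2 : (fun y : V => η ‖y‖ - η 0) =o[𝓝 0] fun y : V => ‖y‖ := by
      simpa [Function.comp_def] using h1
    simpa using h2.of_norm_right
  · have hn : HasFDerivAt (fun x : V => ‖x‖) (‖x‖⁻¹ • innerSL ℝ x) x := by
      have hpos : 0 < ‖x‖ := norm_pos_iff.2 hx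
      have h := ((hasStrictFDerivAt_norm_sq x).hasFDerivAt).sqrt (by positivity)
      simp only [Real.sqrt_sq (norm_nonneg _)] at h
      convert h using 1
      ext v
      simp
      field_simp
    have hpos : ‖x‖ ≠ 0 := norm_ne_zero_iff.2 hx
    have h := (hη ‖x‖).comp_hasFDerivAt x hn
    rw [smul_smul, mul_right_comm, mul_inv_cancel₀ hpos, one_mul] at h
    exact h

variable [FiniteDimensional ℝ V]

/-- The divergence of a vector field, as the trace of its derivative. -/
noncomputable def divergence (X : V → V) (x : V) : ℝ :=
  LinearMap.trace ℝ V (fderiv ℝ X x : V →ₗ[ℝ] V)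

lemma divergence_eq_sum (X : V → V) (x : V) :
    divergence X x = ∑ i, inner ℝ (stdOrthonormalBasis ℝ V i)
      (fderiv ℝ X x (stdOrthonormalBasis ℝ V i)) :=
  LinearMap.trace_eq_sum_inner _ _

lemma continuous_divergence {X : V → V} (hX : ContDiff ℝ 1 X) : Continuous (divergence X) := by
  have hcd : Continuous (fderiv ℝ X) := hX.continuous_fderiv one_ne_zero
  simp only [funext (divergence_eq_sum X)]
  fun_prop

end Divergence

/-! ### Polar coordinates -/

section Polar

variable {V : Type*} [NormedAddCommGroup V] [InnerProductSpace ℝ V] [FiniteDimensional ℝ V]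
  [MeasurableSpace V] [BorelSpace V]

/-- The integral over the unit sphere of `ω ↦ f (r ω)`, i.e. `r^{-(N-1)} ∫_{∂B_r} f`. -/
noncomputable def sphereIntegral (f : V → ℝ) (r : ℝ) : ℝ :=
  ∫ ω : Metric.sphere (0 : V) 1, f (r • (ω : V)) ∂(volume : Measure V).toSphere

lemma continuous_integral_toSphere {F : ℝ → Metric.sphere (0 : V) 1 → ℝ}
    (hF : Continuous F.uncurry) :
    Continuous fun r => ∫ ω, F r ω ∂(volume : Measure V).toSphere := by
  simpa using continuous_parametric_integral_of_continuous
    (μ := (volume : Measure V).toSphere) hF isCompact_univ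

lemma continuous_sphereIntegral {f : V → ℝ} (hf : Continuous f) :
    Continuous (sphereIntegral f) :=
  continuous_integral_toSphere (F := fun r (ω : Metric.sphere (0 : V) 1) => f (r • (ω : V)))
    (by fun_prop)

lemma integrable_toSphere {g : Metric.sphere (0 : V) 1 → ℝ} (hg : Continuous g) :
    Integrable g (volume : Measure V).toSphere :=
  hg.integrable_of_hasCompactSupport (HasCompactSupport.of_compactSpace g)

/-- Integration in polar coordinates. -/
theorem integral_eq_integral_sphereIntegral [Nontrivial V] {f : V → ℝ} (hf : Integrable f) :
    ∫ x, f x = ∫ r in Set.Ioi (0 : ℝ),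
      r ^ (Module.finrank ℝ V - 1) * sphereIntegral f r := by
  set n := Module.finrank ℝ V - 1
  have hmp := (volume : Measure V).measurePreserving_homeomorphUnitSphereProd
  have hemb := (homeomorphUnitSphereProd V).measurableEmbedding
  let g : Metric.sphere (0 : V) 1 × Set.Ioi (0 : ℝ) → ℝ := fun p => f (p.2.1 • (p.1 : V))
  have hcomp : ∀ x : ({0}ᶜ : Set V), g (homeomorphUnitSphereProd V x) = f x := fun x => by
    have h := (homeomorphUnitSphereProd V).symm_apply_apply x
    have h2 := homeomorphUnitSphereProd_symm_apply_coe V (homeomorphUnitSphereProd V x)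
    rw [h] at h2
    simp only [g]
    rw [h2]
  have hgint : Integrable g
      ((volume : Measure V).toSphere.prod (Measure.volumeIoiPow n)) := by
    rw [← hmp.integrable_comp_emb hemb]
    have : g ∘ homeomorphUnitSphereProd V = f ∘ Subtype.val := funext hcomp
    rw [this, ← integrableOn_iff_comap_subtypeVal (measurableSet_singleton _).compl]
    exact hf.integrableOn
  calc
    ∫ x, f x = ∫ x : ({0}ᶜ : Set V), f x ∂((volume : Measure V).comap (↑)) := by
      rw [integral_subtype_comap (measurableSet_singleton _).compl f, restrict_compl_singleton]
    _ = ∫ p, g p ∂((volume : Measure V).toSphere.prod (Measure.volumeIoiPow n)) := by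
      rw [← hmp.integral_comp hemb g]
      simp only [hcomp]
    _ = ∫ r : Set.Ioi (0 : ℝ), sphereIntegral f r ∂(Measure.volumeIoiPow n) :=
      integral_prod_symm g hgint
    _ = _ := by
      simp only [Measure.volumeIoiPow, ENNReal.ofReal]
      rw [integral_withDensity_eq_integral_smul,
        integral_subtype_comap measurableSet_Ioi
          fun a => Real.toNNReal (a ^ n) • sphereIntegral f a]
      · refine setIntegral_congr_fun measurableSet_Ioi fun x hx => ?_
        simp only [NNReal.smul_def, Real.coe_toNNReal _ (pow_nonneg (le_of_lt hx) _), smul_eq_mul]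
      · exact (measurable_subtype_coe.pow_const _).real_toNNReal

lemma sphereIntegral_radial_mul (η : ℝ → ℝ) (f : V → ℝ) {r : ℝ} (hr : 0 < r) :
    sphereIntegral (fun x => η ‖x‖ * f x) r = η r * sphereIntegral f r := by
  simp only [sphereIntegral]
  rw [← integral_const_mul]
  congr 1 with ω
  simp [norm_smul, abs_of_pos hr]

/-- The integral over a ball in polar coordinates. -/
theorem setIntegral_ball_eq [Nontrivial V] {f : V → ℝ} (hf : Continuous f) {r : ℝ} (hr : 0 ≤ r) :
    ∫ x in Metric.ball (0 : V) r, f x =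
      ∫ s in (0 : ℝ)..r, s ^ (Module.finrank ℝ V - 1) * sphereIntegral f s := by
  have hint : IntegrableOn f (Metric.ball (0 : V) r) :=
    (hf.continuousOn.integrableOn_compact (isCompact_closedBall 0 r)).mono_set
      Metric.ball_subset_closedBall
  have hind : (Metric.ball (0 : V) r).indicator f =
      fun x => (Set.Iio r).indicator (fun _ => (1 : ℝ)) ‖x‖ * f x := by
    ext x
    by_cases hx : ‖x‖ < r <;> simp [hx]
  rw [← integral_indicator Metric.isOpen_ball.measurableSet,
    integral_eq_integral_sphereIntegral
      ((integrable_indicator_iff Metric.isOpen_ball.measurableSet).2 hint), hind,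
    intervalIntegral.integral_of_le hr, integral_Ioc_eq_integral_Ioo, ← Set.Ioi_inter_Iio,
    ← setIntegral_indicator measurableSet_Iio]
  refine setIntegral_congr_fun measurableSet_Ioi fun s hs => ?_
  simp only [sphereIntegral_radial_mul _ f hs]
  by_cases h : s < r <;> simp [h]

/-- The derivative of an integral over a ball with respect to the radius (coarea formula). -/
theorem hasDerivAt_setIntegral_ball [Nontrivial V] {f : V → ℝ} (hf : Continuous f) {r : ℝ}
    (hr : 0 < r) :
    HasDerivAt (fun r => ∫ x in Metric.ball (0 : V) r, f x)
      (r ^ (Module.finrank ℝ V - 1) * sphereIntegral f r) r := by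
  have hc : Continuous fun s : ℝ => s ^ (Module.finrank ℝ V - 1) * sphereIntegral f s :=
    (continuous_pow _).mul (continuous_sphereIntegral hf)
  refine (intervalIntegral.integral_hasDerivAt_right (hc.intervalIntegrable 0 r)
    (hc.stronglyMeasurableAtFilter _ _) hc.continuousAt).congr_of_eventuallyEq ?_
  filter_upwards [lt_mem_nhds hr] with s hs
  exact setIntegral_ball_eq hf hs.le

/-- Differentiation of a spherical integral with respect to the radius. -/
theorem hasDerivAt_sphereIntegral {f : V → ℝ} (hf : ContDiff ℝ 1 f) (r : ℝ) :
    HasDerivAt (sphereIntegral f)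
      (∫ ω : Metric.sphere (0 : V) 1, fderiv ℝ f (r • (ω : V)) (ω : V)
        ∂(volume : Measure V).toSphere) r := by
  have hcd : Continuous (fderiv ℝ f) := hf.continuous_fderiv one_ne_zero
  have hF' : Continuous (Function.uncurry fun (s : ℝ) (ω : Metric.sphere (0 : V) 1) =>
      fderiv ℝ f (s • (ω : V)) (ω : V)) := by
    have h1 : Continuous fun p : ℝ × Metric.sphere (0 : V) 1 => fderiv ℝ f (p.1 • (p.2 : V)) :=
      hcd.comp (by fun_prop)
    exact h1.clm_apply (by fun_prop)
  obtain ⟨C, hC⟩ := ((isCompact_closedBall r 1).prod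
    (isCompact_univ (X := Metric.sphere (0 : V) 1))).exists_bound_of_continuousOn hF'.continuousOn
  refine (hasDerivAt_integral_of_dominated_loc_of_deriv_le (bound := fun _ => C)
    (Metric.closedBall_mem_nhds r one_pos)
    (F := fun s (ω : Metric.sphere (0 : V) 1) => f (s • (ω : V)))
    (F' := fun s (ω : Metric.sphere (0 : V) 1) => fderiv ℝ f (s • (ω : V)) (ω : V))
    (.of_forall fun s => ?_) ?_ ?_ ?_ (integrable_const _) ?_).2
  · exact (hf.continuous.comp (by fun_prop)).aestronglyMeasurable
  · exact integrable_toSphere (hf.continuous.comp (by fun_prop))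
  · exact (hF'.comp (by fun_prop : Continuous fun ω => (r, ω))).aestronglyMeasurable
  · exact .of_forall fun ω s hs => hC (s, ω) ⟨hs, Set.mem_univ _⟩
  · refine .of_forall fun ω s _ => ?_
    have h1 : HasDerivAt (fun s : ℝ => s • (ω : V)) (ω : V) s := by
      simpa using (hasDerivAt_id s).smul_const (ω : V)
    exact ((hf.differentiable one_ne_zero _).hasFDerivAt).comp_hasDerivAt s h1

/-! ### The divergence theorem on balls -/

/-- The divergence theorem tested against a compactly supported radial function. -/
lemma integral_radial_mul_divergence {X : V → V} (hX : ContDiff ℝ 1 X) {η χ : ℝ → ℝ} {R : ℝ}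
    (hη : ∀ t, HasDerivAt η (t * χ t) t) (hχ : Continuous χ) (hηR : ∀ t, R ≤ t → η t = 0)
    (hχR : ∀ t, R ≤ t → χ t = 0) :
    ∫ x, η ‖x‖ * divergence X x = -∫ x, χ ‖x‖ * inner ℝ x (X x) := by
  have hηc : Continuous η := continuous_iff_continuousAt.2 fun t => (hη t).continuousAt
  have hcd : Continuous (fderiv ℝ X) := hX.continuous_fderiv one_ne_zero
  have hXc := hX.continuous
  have hcs : ∀ (ζ : ℝ → ℝ) (f : V → ℝ), Continuous ζ → (∀ t, R ≤ t → ζ t = 0) → Continuous f →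
      Integrable fun x => ζ ‖x‖ * f x := by
    intro ζ f hζ hζR hf
    refine (hζ.comp continuous_norm |>.mul hf).integrable_of_hasCompactSupport
      (HasCompactSupport.intro (isCompact_closedBall (0 : V) R) fun x hx => ?_)
    simp only [Metric.mem_closedBall, dist_zero_right, not_le] at hx
    simp [hζR _ hx.le]
  set b := stdOrthonormalBasis ℝ V
  have hg : ∀ i x, HasFDerivAt (fun x => inner ℝ (b i) (X x))
      ((innerSL ℝ (b i)).comp (fderiv ℝ X x)) x := fun i x =>
    (innerSL ℝ (b i)).hasFDerivAt.comp x (hX.differentiable one_ne_zero x).hasFDerivAt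
  have key : ∀ i, ∫ x, η ‖x‖ * inner ℝ (b i) (fderiv ℝ X x (b i)) =
      -∫ x, χ ‖x‖ * (inner ℝ x (b i) * inner ℝ (b i) (X x)) := by
    intro i
    have h := integral_bilinear_hasFDerivAt_right_eq_neg_left_of_integrable
      (μ := (volume : Measure V)) (B := ContinuousLinearMap.mul ℝ ℝ) (v := b i)
      (f := fun x : V => η ‖x‖) (f' := fun x => χ ‖x‖ • innerSL ℝ x)
      (g := fun x => inner ℝ (b i) (X x)) (g' := fun x => (innerSL ℝ (b i)).comp (fderiv ℝ X x))
      ?_ ?_ ?_ (fun x _ => hasFDerivAt_radial hη x) (fun x _ => hg i x)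
    · simpa [mul_assoc] using h
    · simpa [mul_assoc] using hcs χ (fun x => inner ℝ x (b i) * inner ℝ (b i) (X x)) hχ hχR
        (by fun_prop)
    · simpa using hcs η (fun x => inner ℝ (b i) (fderiv ℝ X x (b i))) hηc hηR (by fun_prop)
    · simpa using hcs η (fun x => inner ℝ (b i) (X x)) hηc hηR (by fun_prop)
  have hsplit : ∀ x, inner ℝ x (X x) = ∑ i, inner ℝ x (b i) * inner ℝ (b i) (X x) := fun x =>
    (b.sum_inner_mul_inner x (X x)).symm
  simp only [divergence_eq_sum, hsplit, Finset.mul_sum]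
  rw [integral_finsetSum, integral_finsetSum, ← Finset.sum_neg_distrib]
  · exact Finset.sum_congr rfl fun i _ => key i
  · exact fun i _ => hcs χ _ hχ hχR (by fun_prop)
  · exact fun i _ => hcs η _ hηc hηR (by fun_prop)

/-- **Divergence theorem** on the ball `B_r`, multiplied by `r`: the outer normal is replaced by
the position vector. -/
theorem mul_integral_ball_divergence [Nontrivial V] {X : V → V} (hX : ContDiff ℝ 1 X) {r : ℝ}
    (hr : 0 < r) :
    r * ∫ x in Metric.ball (0 : V) r, divergence X x =
      r ^ (Module.finrank ℝ V - 1) * sphereIntegral (fun x => inner ℝ x (X x)) r := by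
  set n := Module.finrank ℝ V - 1
  set S := sphereIntegral fun x => inner ℝ x (X x) with hS
  have hXc := hX.continuous
  have hScont : Continuous S := continuous_sphereIntegral (by fun_prop)
  set D := sphereIntegral (divergence X) with hD
  have hDcont : Continuous D := continuous_sphereIntegral (continuous_divergence hX)
  have hgcont : Continuous fun s => s ^ n * D s := (continuous_pow _).mul hDcont
  set Φ : ℝ → ℝ := fun t => ∫ s in (0 : ℝ)..t, s ^ n * D s with hΦ
  have hΦd : ∀ t, HasDerivAt Φ (t ^ n * D t) t := fun t =>
    intervalIntegral.integral_hasDerivAt_right (hgcont.intervalIntegrable 0 t)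
      (hgcont.stronglyMeasurableAtFilter _ _) hgcont.continuousAt
  have hΦcont : Continuous Φ := continuous_iff_continuousAt.2 fun t => (hΦd t).continuousAt
  have hdiff : Continuous fun s => s * Φ s - s ^ n * S s := by fun_prop
  -- Both sides agree as distributions in the radius, hence everywhere by continuity.
  have hae : ∀ᵐ s : ℝ, s ∈ Set.Ioi (0 : ℝ) → s * Φ s - s ^ n * S s = 0 := by
    refine isOpen_Ioi.ae_eq_zero_of_integral_contDiff_smul_eq_zero
      (hdiff.locallyIntegrable.locallyIntegrableOn _) fun χ hχs hχc hχ0 => ?_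
    have hχ := hχs.continuous
    obtain ⟨R, hR0, hR⟩ : ∃ R, 0 < R ∧ ∀ t, R ≤ t → χ t = 0 := by
      obtain ⟨R, hR⟩ := hχc.isCompact.isBounded.subset_closedBall 0
      refine ⟨max R 0 + 1, by positivity, fun t ht => ?_⟩
      by_contra hne
      have h1 := hR (subset_tsupport χ hne)
      rw [Metric.mem_closedBall, dist_zero_right, Real.norm_eq_abs] at h1
      linarith [le_abs_self t, le_max_left R 0]
    have hψ : Continuous fun t => t * χ t := by fun_prop
    set η : ℝ → ℝ := fun t => ∫ s in R..t, s * χ s with hηdef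
    have hη : ∀ t, HasDerivAt η (t * χ t) t := fun t =>
      intervalIntegral.integral_hasDerivAt_right (hψ.intervalIntegrable R t)
        (hψ.stronglyMeasurableAtFilter _ _) hψ.continuousAt
    have hηc : Continuous η := continuous_iff_continuousAt.2 fun t => (hη t).continuousAt
    have hηR : ∀ t, R ≤ t → η t = 0 := fun t ht => by
      simp only [hηdef]
      rw [intervalIntegral.integral_congr (g := fun _ => (0 : ℝ))]
      · simp
      · intro s hs
        rw [Set.uIcc_of_le ht] at hs
        simp [hR s hs.1]
    have hcs : ∀ (ζ : ℝ → ℝ) (f : V → ℝ), Continuous ζ → (∀ t, R ≤ t → ζ t = 0) →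
        Continuous f → ∫ x, ζ ‖x‖ * f x = ∫ s in (0 : ℝ)..R, ζ s * (s ^ n * sphereIntegral f s) := by
      intro ζ f hζ hζR hf
      have hint : Integrable fun x : V => ζ ‖x‖ * f x := by
        refine (hζ.comp continuous_norm |>.mul hf).integrable_of_hasCompactSupport
          (HasCompactSupport.intro (isCompact_closedBall (0 : V) R) fun x hx => ?_)
        simp only [Metric.mem_closedBall, dist_zero_right, not_le] at hx
        simp [hζR _ hx.le]
      rw [integral_eq_integral_sphereIntegral hint, intervalIntegral.integral_of_le hR0.le,
        setIntegral_congr_fun measurableSet_Ioi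
          (g := fun s => ζ s * (s ^ n * sphereIntegral f s)) fun s hs => by
            simp only [sphereIntegral_radial_mul ζ f hs]; ring]
      refine setIntegral_eq_of_subset_of_forall_sdiff_eq_zero measurableSet_Ioi
        Set.Ioc_subset_Ioi_self fun s hs => ?_
      have : R ≤ s := by
        by_contra! hlt
        exact hs.2 ⟨hs.1, hlt.le⟩
      simp [hζR s this]
    have hdiv := integral_radial_mul_divergence hX hη hχ hηR hR
    rw [hcs η _ hηc hηR (continuous_divergence hX),
      hcs χ _ hχ hR (by fun_prop : Continuous fun x => inner ℝ x (X x)),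
      intervalIntegral.integral_mul_deriv_eq_deriv_mul (fun t _ => hη t) (fun t _ => hΦd t)
        (hψ.intervalIntegrable _ _) (hgcont.intervalIntegrable _ _), hηR R le_rfl,
      show Φ 0 = 0 by simp [hΦ]] at hdiv
    have hχneg : ∀ t, t ∉ Set.Ioc 0 R → χ t = 0 := fun t ht => by
      by_contra hne
      have h1 : 0 < t := hχ0 (subset_tsupport χ hne)
      have h2 : t < R := by
        by_contra! hle
        exact hne (hR t hle)
      exact ht ⟨h1, h2.le⟩
    rw [← setIntegral_eq_integral_of_forall_compl_eq_zero (s := Set.Ioc 0 R)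
      fun t ht => by simp [hχneg t ht], ← intervalIntegral.integral_of_le hR0.le]
    simp only [smul_eq_mul, mul_sub]
    rw [intervalIntegral.integral_sub
      ((by fun_prop : Continuous fun t => χ t * (t * Φ t)).intervalIntegrable _ _)
      ((by fun_prop : Continuous fun t => χ t * (t ^ n * S t)).intervalIntegrable _ _)]
    have hcomm : ∀ t, χ t * (t * Φ t) = t * χ t * Φ t := fun t => by ring
    simp only [hcomm]
    linarith
  have hz : Set.EqOn (fun s => s * Φ s - s ^ n * S s) (fun _ => 0) (Set.Ioi (0 : ℝ)) :=
    Measure.eqOn_open_of_ae_eq (μ := volume)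
      ((ae_restrict_iff' measurableSet_Ioi).2 hae) isOpen_Ioi hdiff.continuousOn
      continuousOn_const
  rw [setIntegral_ball_eq (continuous_divergence hX) hr.le]
  exact sub_eq_zero.1 (hz hr)

end Polar

/-! ### Divergence identities -/

section Identities

variable {V : Type*} [NormedAddCommGroup V] [InnerProductSpace ℝ V]

lemma divergence_sub {X Y : V → V} {x : V} (hX : DifferentiableAt ℝ X x)
    (hY : DifferentiableAt ℝ Y x) :
    divergence (fun y => X y - Y y) x = divergence X x - divergence Y x := by
  simp [divergence, fderiv_fun_sub hX hY]

lemma divergence_sum {ι : Type*} (s : Finset ι) {X : ι → V → V} {x : V}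
    (hX : ∀ i ∈ s, DifferentiableAt ℝ (X i) x) :
    divergence (fun y => ∑ i ∈ s, X i y) x = ∑ i ∈ s, divergence (X i) x := by
  simp [divergence, fderiv_fun_sum hX]

variable [FiniteDimensional ℝ V]

lemma ContDiff.gradient {f : V → ℝ} (hf : ContDiff ℝ 2 f) : ContDiff ℝ 1 (gradient f) :=
  (InnerProductSpace.toDual ℝ V).symm.toContinuousLinearEquiv.contDiff.comp
    (hf.fderiv_right (by norm_num))

lemma inner_fderiv_gradient {f : V → ℝ} (hf : ContDiff ℝ 2 f) (x v w : V) :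
    inner ℝ (fderiv ℝ (gradient f) x v) w = fderiv ℝ (fderiv ℝ f) x v w := by
  have h1 : HasFDerivAt (fun y => inner ℝ (gradient f y) w)
      ((innerSL ℝ w).comp (fderiv ℝ (gradient f) x)) x := by
    have := (innerSL ℝ w).hasFDerivAt.comp x
      (hf.gradient.differentiable one_ne_zero x).hasFDerivAt
    refine this.congr_of_eventuallyEq (.of_forall fun y => ?_)
    simp
  have h2 : HasFDerivAt (fun y => fderiv ℝ f y w) ((fderiv ℝ (fderiv ℝ f) x).flip w) x := by
    have hd : ContDiff ℝ 1 (fderiv ℝ f) := hf.fderiv_right (by norm_num)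
    have := (hd.differentiable one_ne_zero x).hasFDerivAt.clm_apply (hasFDerivAt_const w x)
    simpa using this
  simp only [inner_gradient_left] at h1
  have := congrArg (fun L => L v) (h1.unique h2)
  simpa [real_inner_comm] using this

/-- The Hessian is symmetric. -/
lemma inner_fderiv_gradient_comm {f : V → ℝ} (hf : ContDiff ℝ 2 f) (x v w : V) :
    inner ℝ (fderiv ℝ (gradient f) x v) w = inner ℝ (fderiv ℝ (gradient f) x w) v := by
  rw [inner_fderiv_gradient hf, inner_fderiv_gradient hf]
  exact (hf.contDiffAt.isSymmSndFDerivAt (by simp)) v w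

lemma divergence_gradient {f : V → ℝ} (hf : ContDiff ℝ 2 f) (x : V) :
    divergence (gradient f) x = Laplacian.laplacian f x := by
  rw [divergence_eq_sum,
    InnerProductSpace.laplacian_eq_iteratedFDeriv_orthonormalBasis f (stdOrthonormalBasis ℝ V)]
  refine Finset.sum_congr rfl fun i _ => ?_
  rw [real_inner_comm, inner_fderiv_gradient hf, iteratedFDeriv_two_apply]
  simp

lemma divergence_smul {f : V → ℝ} {X : V → V} {x : V} (hf : DifferentiableAt ℝ f x)
    (hX : DifferentiableAt ℝ X x) :
    divergence (fun y => f y • X y) x = f x * divergence X x + fderiv ℝ f x (X x) := by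
  rw [divergence, fderiv_fun_smul hf hX]
  simp only [ContinuousLinearMap.toLinearMap_add, ContinuousLinearMap.toLinearMap_smul, map_add,
    map_smul, smul_eq_mul]
  congr 1
  exact LinearMap.trace_smulRight (fderiv ℝ f x : V →ₗ[ℝ] ℝ) (X x)

lemma divergence_id (x : V) : divergence (fun y : V => y) x = Module.finrank ℝ V := by
  simp [divergence, LinearMap.trace_id]

end Identities

/-! ### Algebra of the interaction term -/

/-- The potential `∑_{i < j} aᵢ² aⱼ²` in symmetric form. -/
lemma sum_Ioi_sq_mul_sq {k : ℕ} (a : Fin k → ℝ) :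
    ∑ i, ∑ j ∈ Finset.Ioi i, a i ^ 2 * a j ^ 2 =
      ((∑ i, a i ^ 2) ^ 2 - ∑ i, (a i ^ 2) ^ 2) / 2 := by
  have h : (∑ i, a i ^ 2) ^ 2 = ∑ i, (a i ^ 2) ^ 2
      + 2 * ∑ i, ∑ j ∈ Finset.Ioi i, a i ^ 2 * a j ^ 2 := by
    have hswap : ∑ i, ∑ j ∈ Finset.Iio i, a i ^ 2 * a j ^ 2 =
        ∑ i, ∑ j ∈ Finset.Ioi i, a i ^ 2 * a j ^ 2 := by
      rw [Finset.sum_comm' (t' := Finset.univ) (s' := fun j => Finset.Ioi j) (by simp)]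
      exact Finset.sum_congr rfl fun i _ => Finset.sum_congr rfl fun j _ => mul_comm _ _
    rw [sq, Finset.sum_mul_sum, two_mul]
    nth_rewrite 1 [← hswap]
    rw [← Finset.sum_add_distrib, ← Finset.sum_add_distrib]
    refine Finset.sum_congr rfl fun i _ => ?_
    have hu : (Finset.univ : Finset (Fin k)) =
        insert i (Finset.Iio i ∪ Finset.Ioi i) := by
      ext j; simp; omega
    rw [hu, Finset.sum_insert (by simp), Finset.sum_union]
    · ring
    · rw [Finset.disjoint_left]
      intro j hj hj'
      simp only [Finset.mem_Iio, Finset.mem_Ioi] at hj hj'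
      exact lt_asymm hj hj'
  linarith

lemma sum_ne_sq_mul {k : ℕ} (a : Fin k → ℝ) (i : Fin k) :
    ∑ j ∈ Finset.univ.filter (fun j => j ≠ i), a j ^ 2 * a i =
      (∑ j, a j ^ 2 - a i ^ 2) * a i := by
  rw [← Finset.sum_mul, Finset.filter_ne', ← Finset.sum_erase_add _ _ (Finset.mem_univ i)]
  ring

/-! ### The vector fields of the competitive system -/

section Fields

variable {N k : ℕ}

/-- The interaction density `∑_{i < j} uᵢ² uⱼ²`. -/
noncomputable def interactionDensity (u : Fin k → RSpace N → ℝ) (x : RSpace N) : ℝ :=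
  ∑ i, ∑ j ∈ Finset.Ioi i, u i x ^ 2 * u j x ^ 2

/-- The energy density `∑ᵢ |∇uᵢ|² + ∑_{i < j} uᵢ² uⱼ²`. -/
noncomputable def energyDensity (u : Fin k → RSpace N → ℝ) (x : RSpace N) : ℝ :=
  ∑ i, ‖gradient (u i) x‖ ^ 2 + ∑ i, ∑ j ∈ Finset.Ioi i, u i x ^ 2 * u j x ^ 2

/-- The vector field `∑ᵢ uᵢ ∇uᵢ = ½ ∇ ∑ᵢ uᵢ²`. -/
noncomputable def massFlux (u : Fin k → RSpace N → ℝ) (x : RSpace N) : RSpace N :=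
  ∑ i, u i x • gradient (u i) x

/-- The vector field `e x - 2 ∑ᵢ ⟪x, ∇uᵢ⟫ ∇uᵢ` behind the Pohozaev identity, where `e` is the
energy density. -/
noncomputable def pohozaevField (u : Fin k → RSpace N → ℝ) (x : RSpace N) : RSpace N :=
  energyDensity u x • x - ∑ i, (2 * inner ℝ x (gradient (u i) x)) • gradient (u i) x

lemma interactionDensity_nonneg (u : Fin k → RSpace N → ℝ) (x : RSpace N) :
    0 ≤ interactionDensity u x := by
  unfold interactionDensity; positivity

lemma energyDensity_nonneg (u : Fin k → RSpace N → ℝ) (x : RSpace N) :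
    0 ≤ energyDensity u x := by
  unfold energyDensity; positivity

variable {u : Fin k → RSpace N → ℝ}

lemma contDiff_interactionDensity (hu : ∀ i, ContDiff ℝ 2 (u i)) :
    ContDiff ℝ 1 (interactionDensity u) := by
  have h1 : ∀ i, ContDiff ℝ 1 (u i) := fun i => (hu i).of_le (by norm_num)
  unfold interactionDensity
  fun_prop

lemma contDiff_energyDensity (hu : ∀ i, ContDiff ℝ 2 (u i)) :
    ContDiff ℝ 1 (energyDensity u) := by
  have h2 : ∀ i, ContDiff ℝ 1 (gradient (u i)) := fun i => (hu i).gradient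
  have h3 := contDiff_interactionDensity hu
  unfold interactionDensity at h3
  unfold energyDensity
  exact (ContDiff.sum fun i _ => (h2 i).norm_sq ℝ).add h3

lemma contDiff_massFlux (hu : ∀ i, ContDiff ℝ 2 (u i)) : ContDiff ℝ 1 (massFlux u) := by
  have h1 : ∀ i, ContDiff ℝ 1 (u i) := fun i => (hu i).of_le (by norm_num)
  have h2 : ∀ i, ContDiff ℝ 1 (gradient (u i)) := fun i => (hu i).gradient
  exact ContDiff.sum fun i _ => (h1 i).smul (h2 i)

lemma contDiff_pohozaevField (hu : ∀ i, ContDiff ℝ 2 (u i)) : ContDiff ℝ 1 (pohozaevField u) := by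
  have h2 : ∀ i, ContDiff ℝ 1 (gradient (u i)) := fun i => (hu i).gradient
  exact ((contDiff_energyDensity hu).smul contDiff_id).sub
    (ContDiff.sum fun i _ => (contDiff_const.mul (contDiff_id.inner ℝ (h2 i))).smul (h2 i))

lemma laplacian_eq (hu : IsNonnegSolution u) (i : Fin k) (x : RSpace N) :
    Laplacian.laplacian (u i) x = (∑ j, u j x ^ 2 - u i x ^ 2) * u i x := by
  rw [← sum_ne_sq_mul (fun j => u j x)]
  exact neg_injective (hu.equation i x)

lemma divergence_massFlux (hu : IsNonnegSolution u) (x : RSpace N) :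
    divergence (massFlux u) x = energyDensity u x + interactionDensity u x := by
  have h1 : ∀ i, DifferentiableAt ℝ (u i) x := fun i =>
    (hu.contDiff i).differentiable two_ne_zero x
  have h2 : ∀ i, DifferentiableAt ℝ (gradient (u i)) x := fun i =>
    (hu.contDiff i).gradient.differentiable one_ne_zero x
  unfold massFlux energyDensity interactionDensity
  rw [divergence_sum _ fun i _ => (h1 i).fun_smul (h2 i), sum_Ioi_sq_mul_sq fun i => u i x]
  simp only [divergence_smul (h1 _) (h2 _), divergence_gradient (hu.contDiff _),
    laplacian_eq hu, ← inner_gradient_left, real_inner_self_eq_norm_sq]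
  rw [Finset.sum_add_distrib]
  have : ∑ i, u i x * ((∑ j, u j x ^ 2 - u i x ^ 2) * u i x) =
      (∑ i, u i x ^ 2) ^ 2 - ∑ i, (u i x ^ 2) ^ 2 := by
    rw [sq (∑ i, u i x ^ 2), Finset.sum_mul, ← Finset.sum_sub_distrib]
    exact Finset.sum_congr rfl fun i _ => by ring
  rw [this]
  ring

/-- The variational structure of the system: `Δ uᵢ` is half the partial derivative of the
interaction density with respect to `uᵢ`. -/
lemma fderiv_interactionDensity (hu : IsNonnegSolution u) (x v : RSpace N) :
    fderiv ℝ (interactionDensity u) x v =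
      ∑ i, 2 * Laplacian.laplacian (u i) x * inner ℝ (gradient (u i) x) v := by
  have h1 : ∀ i, HasFDerivAt (u i) (fderiv ℝ (u i) x) x := fun i =>
    ((hu.contDiff i).differentiable two_ne_zero x).hasFDerivAt
  have hform : interactionDensity u =
      fun y => ((∑ i, u i y ^ 2) ^ 2 - ∑ i, (u i y ^ 2) ^ 2) * (1 / 2) := by
    ext y
    rw [interactionDensity, sum_Ioi_sq_mul_sq fun i => u i y]
    ring
  have hS : HasFDerivAt (fun y => ∑ i, u i y ^ 2) _ x := .fun_sum fun i _ => (h1 i).pow 2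
  have hT : HasFDerivAt (fun y => ∑ i, (u i y ^ 2) ^ 2) _ x :=
    .fun_sum fun i _ => ((h1 i).pow 2).pow 2
  have hW := ((hS.pow 2).fun_sub hT).mul_const (1 / 2)
  rw [hform, HasFDerivAt.fderiv hW]
  simp only [laplacian_eq hu, inner_gradient_left]
  simp
  rw [Finset.mul_sum, ← Finset.sum_sub_distrib, Finset.mul_sum]
  exact Finset.sum_congr rfl fun i _ => by ring

lemma divergence_pohozaevField (hu : IsNonnegSolution u) (x : RSpace N) :
    divergence (pohozaevField u) x =
      ((N : ℝ) - 2) * energyDensity u x + 2 * interactionDensity u x := by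
  have h2 : ∀ i, DifferentiableAt ℝ (gradient (u i)) x := fun i =>
    (hu.contDiff i).gradient.differentiable one_ne_zero x
  have h3 : ∀ i, HasFDerivAt (fun y : RSpace N => 2 * inner ℝ y (gradient (u i) y)) _ x := fun i =>
    ((hasFDerivAt_id x).inner ℝ (h2 i).hasFDerivAt).const_mul 2
  have he : DifferentiableAt ℝ (energyDensity u) x :=
    (contDiff_energyDensity hu.contDiff).differentiable one_ne_zero x
  have hW : HasFDerivAt (interactionDensity u) (fderiv ℝ (interactionDensity u) x) x :=
    ((contDiff_interactionDensity hu.contDiff).differentiable one_ne_zero x).hasFDerivAt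
  have hed : HasFDerivAt (energyDensity u) _ x :=
    (HasFDerivAt.fun_sum (u := Finset.univ) fun i _ => (h2 i).hasFDerivAt.norm_sq).add hW
  unfold pohozaevField
  rw [divergence_sub (he.fun_smul differentiableAt_fun_id)
      (.fun_sum fun i _ => (h3 i).differentiableAt.fun_smul (h2 i)),
    divergence_sum _ fun i _ => (h3 i).differentiableAt.fun_smul (h2 i),
    divergence_smul he differentiableAt_fun_id]
  simp only [divergence_smul (h3 _).differentiableAt (h2 _), (h3 _).fderiv, hed.fderiv,
    divergence_gradient (hu.contDiff _), divergence_id]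
  simp [fderiv_interactionDensity hu, -inner_gradient_left, -inner_gradient_right]
  have he' : energyDensity u x = ∑ i, ‖gradient (u i) x‖ ^ 2 + interactionDensity u x := rfl
  -- The symmetry of the Hessian and the equation cancel everything but `- 2 ∑ᵢ |∇uᵢ|²`.
  have hcancel : (∑ i, 2 * inner ℝ (gradient (u i) x) (fderiv ℝ (gradient (u i)) x x) +
        ∑ i, 2 * Laplacian.laplacian (u i) x * inner ℝ (gradient (u i) x) x) -
      ∑ i, (2 * inner ℝ x (gradient (u i) x) * Laplacian.laplacian (u i) x +
          2 * (inner ℝ x (fderiv ℝ (gradient (u i)) x (gradient (u i) x)) +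
            ‖gradient (u i) x‖ ^ 2)) = -2 * ∑ i, ‖gradient (u i) x‖ ^ 2 := by
    rw [← Finset.sum_add_distrib, ← Finset.sum_sub_distrib, Finset.mul_sum]
    refine Finset.sum_congr rfl fun i _ => ?_
    rw [real_inner_comm (fderiv ℝ (gradient (u i)) x (gradient (u i) x)) x,
      inner_fderiv_gradient_comm (hu.contDiff i) x (gradient (u i) x) x,
      real_inner_comm (gradient (u i) x) x,
      real_inner_comm (fderiv ℝ (gradient (u i)) x x) (gradient (u i) x)]
    ring
  rw [add_sub_assoc, hcancel]
  linarith

end Fields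

/-! ### The frequency system of a solution -/

section Solution

variable {N k : ℕ} {u : Fin k → RSpace N → ℝ}

lemma almgrenH_eq_sphereIntegral (hu : ∀ i, Continuous (u i)) {r : ℝ} (hr : 0 < r) :
    almgrenH u 0 r = sphereIntegral (fun x => ∑ i, u i x ^ 2) r := by
  have hpow : 0 < r ^ ((N : ℤ) - 1) := zpow_pos hr _
  unfold almgrenH sphereMeasure sphereIntegral
  rw [integral_smul_measure, integral_map, ENNReal.toReal_ofReal hpow.le]
  · simp only [zero_add, smul_eq_mul]
    field_simp
  · exact (by fun_prop : Continuous fun ω : Metric.sphere (0 : RSpace N) 1 =>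
      (0 : RSpace N) + r • (ω : RSpace N)).measurable.aemeasurable
  · exact (by fun_prop : Continuous fun x => ∑ i, u i x ^ 2).aestronglyMeasurable

lemma almgrenE_eq (hN : 1 ≤ N) {r : ℝ} (hr : 0 < r) :
    almgrenE u 0 r = r * (∫ x in Metric.ball (0 : RSpace N) r, energyDensity u x) /
      r ^ (N - 1) := by
  obtain ⟨n, rfl⟩ : ∃ n, N = n + 1 := ⟨N - 1, by omega⟩
  have h : r ^ (((n + 1 : ℕ) : ℤ) - 2) = r ^ n / r := by
    rw [show (((n + 1 : ℕ) : ℤ) - 2) = (n : ℤ) - 1 by push_cast; ring, zpow_sub_one₀ hr.ne',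
      zpow_natCast, div_eq_mul_inv]
  unfold almgrenE
  rw [h, Nat.add_sub_cancel]
  simp only [energyDensity]
  field_simp

/-- `∫_{∂B_r} ∑ᵢ uᵢ ∂_ν uᵢ`, scaled by `r ^ (1 - N)`. -/
noncomputable def radialFlux (u : Fin k → RSpace N → ℝ) (r : ℝ) : ℝ :=
  ∫ ω : Metric.sphere (0 : RSpace N) 1,
    ∑ i, u i (r • (ω : RSpace N)) * inner ℝ (ω : RSpace N) (gradient (u i) (r • (ω : RSpace N)))
    ∂(volume : Measure (RSpace N)).toSphere

/-- `∫_{∂B_r} ∑ᵢ (∂_ν uᵢ)²`, scaled by `r ^ (1 - N)`. -/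
noncomputable def radialEnergy (u : Fin k → RSpace N → ℝ) (r : ℝ) : ℝ :=
  ∫ ω : Metric.sphere (0 : RSpace N) 1,
    ∑ i, inner ℝ (ω : RSpace N) (gradient (u i) (r • (ω : RSpace N))) ^ 2
    ∂(volume : Measure (RSpace N)).toSphere

/-- `∫_{B_r} ∑_{i < j} uᵢ² uⱼ²`, scaled by `r ^ (2 - N)`. -/
noncomputable def scaledInteraction (u : Fin k → RSpace N → ℝ) (r : ℝ) : ℝ :=
  r * (∫ x in Metric.ball (0 : RSpace N) r, interactionDensity u x) / r ^ (N - 1)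

lemma continuous_comp_sphere {f : RSpace N → ℝ} (hf : Continuous f) (r : ℝ) :
    Continuous fun ω : Metric.sphere (0 : RSpace N) 1 => f (r • (ω : RSpace N)) :=
  hf.comp (by fun_prop)

lemma continuous_radialDeriv {f : RSpace N → ℝ} (hf : ContDiff ℝ 2 f) (r : ℝ) :
    Continuous fun ω : Metric.sphere (0 : RSpace N) 1 =>
      inner ℝ (ω : RSpace N) (gradient f (r • (ω : RSpace N))) := by
  have h : Continuous fun ω : Metric.sphere (0 : RSpace N) 1 => gradient f (r • (ω : RSpace N)) :=
    hf.gradient.continuous.comp (by fun_prop)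
  exact continuous_subtype_val.inner h

lemma hasDerivAt_almgrenH (hu : ∀ i, ContDiff ℝ 2 (u i)) {r : ℝ} (hr : 0 < r) :
    HasDerivAt (almgrenH u 0) (2 * radialFlux u r) r := by
  have h1 : ∀ i, ContDiff ℝ 1 (u i) := fun i => (hu i).of_le (by norm_num)
  have hd := hasDerivAt_sphereIntegral
    (by fun_prop : ContDiff ℝ 1 fun x => ∑ i, u i x ^ 2) r
  have heq : almgrenH u 0 =ᶠ[𝓝 r] sphereIntegral fun x => ∑ i, u i x ^ 2 := by
    filter_upwards [lt_mem_nhds hr] with s hs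
    exact almgrenH_eq_sphereIntegral (fun i => (hu i).continuous) hs
  refine (hd.congr_of_eventuallyEq heq).congr_deriv ?_
  rw [radialFlux, ← integral_const_mul]
  congr 1 with ω
  have hf : HasFDerivAt (fun x => ∑ i, u i x ^ 2) _ (r • (ω : RSpace N)) :=
    .fun_sum fun i _ => ((h1 i).differentiable one_ne_zero _).hasFDerivAt.pow 2
  rw [hf.fderiv]
  simp [Finset.mul_sum, mul_assoc]

/-- `∫_{∂B_r} ∑ᵢ uᵢ ∂_ν uᵢ = ∫_{B_r} (∑ᵢ |∇uᵢ|² + 2 ∑_{i < j} uᵢ² uⱼ²)`. -/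
lemma mul_radialFlux_eq (hN : 1 ≤ N) (hu : IsNonnegSolution u) {r : ℝ} (hr : 0 < r) :
    r * radialFlux u r = almgrenE u 0 r + scaledInteraction u r := by
  have : Nontrivial (RSpace N) := Module.nontrivial_of_finrank_pos (R := ℝ) (by simp; omega)
  have he := contDiff_energyDensity hu.contDiff
  have hW := contDiff_interactionDensity hu.contDiff
  have hdiv := mul_integral_ball_divergence (contDiff_massFlux hu.contDiff) hr
  simp only [divergence_massFlux hu, finrank_euclideanSpace_fin] at hdiv
  rw [integral_add] at hdiv
  rotate_left
  · exact (he.continuous.continuousOn.integrableOn_compact (isCompact_closedBall 0 r)).mono_set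
      Metric.ball_subset_closedBall
  · exact (hW.continuous.continuousOn.integrableOn_compact (isCompact_closedBall 0 r)).mono_set
      Metric.ball_subset_closedBall
  have hS : sphereIntegral (fun x => inner ℝ x (massFlux u x)) r = r * radialFlux u r := by
    rw [radialFlux, ← integral_const_mul, sphereIntegral]
    congr 1 with ω
    simp [massFlux, inner_sum, inner_smul_left, inner_smul_right, Finset.mul_sum,
      -inner_gradient_right, mul_left_comm]
  rw [hS] at hdiv
  have hpow : 0 < r ^ (N - 1) := pow_pos hr _
  rw [almgrenE_eq hN hr, scaledInteraction, ← add_div, ← mul_add, hdiv]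
  field_simp

/-- The derivative of the scaled energy, by the Pohozaev identity. -/
lemma hasDerivAt_almgrenE (hN : 1 ≤ N) (hu : IsNonnegSolution u) {r : ℝ} (hr : 0 < r) :
    HasDerivAt (almgrenE u 0)
      (2 * scaledInteraction u r / r + 2 * r * radialEnergy u r) r := by
  have : Nontrivial (RSpace N) := Module.nontrivial_of_finrank_pos (R := ℝ) (by simp; omega)
  have he := contDiff_energyDensity hu.contDiff
  have hW := contDiff_interactionDensity hu.contDiff
  have hdiv := mul_integral_ball_divergence (contDiff_pohozaevField hu.contDiff) hr
  simp only [divergence_pohozaevField hu, finrank_euclideanSpace_fin] at hdiv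
  rw [integral_add, integral_const_mul, integral_const_mul] at hdiv
  rotate_left
  · exact (((he.continuous.continuousOn.integrableOn_compact
      (isCompact_closedBall 0 r)).mono_set Metric.ball_subset_closedBall)).const_mul _
  · exact ((hW.continuous.continuousOn.integrableOn_compact (isCompact_closedBall 0 r)).mono_set
      Metric.ball_subset_closedBall).const_mul _
  have hS : sphereIntegral (fun x => inner ℝ x (pohozaevField u x)) r =
      r ^ 2 * (sphereIntegral (energyDensity u) r - 2 * radialEnergy u r) := by
    have hq : Integrable (fun ω : Metric.sphere (0 : RSpace N) 1 =>
        ∑ i, inner ℝ (ω : RSpace N) (gradient (u i) (r • (ω : RSpace N))) ^ 2)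
        (volume : Measure (RSpace N)).toSphere :=
      integrable_toSphere (continuous_finsetSum _ fun i _ =>
        (continuous_radialDeriv (hu.contDiff i) r).pow 2)
    rw [radialEnergy, sphereIntegral, sphereIntegral, ← integral_const_mul,
      ← integral_sub (integrable_toSphere (continuous_comp_sphere he.continuous r))
        (hq.const_mul 2), ← integral_const_mul]
    congr 1 with ω
    have hω : inner ℝ (ω : RSpace N) (ω : RSpace N) = 1 := by simp
    simp only [pohozaevField, inner_sub_right, inner_sum, inner_smul_left, inner_smul_right,
      hω, Finset.mul_sum, mul_sub]
    simp only [RCLike.conj_to_real]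
    congr 1
    · ring
    · exact Finset.sum_congr rfl fun i _ => by ring
  rw [hS] at hdiv
  have hd := hasDerivAt_setIntegral_ball he.continuous hr
  rw [finrank_euclideanSpace_fin] at hd
  have heq : almgrenE u 0 =ᶠ[𝓝 r] fun r =>
      r * (∫ x in Metric.ball (0 : RSpace N) r, energyDensity u x) / r ^ (N - 1) := by
    filter_upwards [lt_mem_nhds hr] with s hs
    exact almgrenE_eq hN hs
  have hpow : 0 < r ^ (N - 1) := pow_pos hr _
  refine ((((hasDerivAt_id r).mul hd).div (hasDerivAt_pow (N - 1) r) hpow.ne'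
    ).congr_of_eventuallyEq heq).congr_deriv ?_
  obtain ⟨n, rfl⟩ : ∃ n, N = n + 1 := ⟨N - 1, by omega⟩
  simp only [scaledInteraction, Nat.add_sub_cancel, Pi.mul_apply, id] at hdiv hpow ⊢
  push_cast at hdiv
  set P := ∫ x in Metric.ball (0 : RSpace (n + 1)) r, energyDensity u x
  set w := ∫ x in Metric.ball (0 : RSpace (n + 1)) r, interactionDensity u x
  have hn : (n : ℝ) * r ^ (n - 1) * r = n * r ^ n := by
    rcases n with _ | n
    · simp
    · simp [pow_succ, mul_assoc]
  have hdiv' : ((n : ℝ) + 1 - 2) * P + 2 * w =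
      r ^ n * (r * (sphereIntegral (energyDensity u) r - 2 * radialEnergy u r)) :=
    mul_left_cancel₀ hr.ne' (by rw [hdiv]; ring)
  have hright : (2 * (r * w / r ^ n) / r + 2 * r * radialEnergy u r) * (r ^ n) ^ 2 =
      2 * w * r ^ n + 2 * r * radialEnergy u r * (r ^ n) ^ 2 := by
    field_simp
  rw [div_eq_iff (by positivity), hright]
  linear_combination (-r ^ n) * hdiv' - P * hn

lemma radialFlux_sq_le (hu : ∀ i, ContDiff ℝ 2 (u i)) {r : ℝ} (hr : 0 < r) :
    radialFlux u r ^ 2 ≤ almgrenH u 0 r * radialEnergy u r := by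
  have hc : ∀ i, Continuous (u i) := fun i => (hu i).continuous
  have h1 := fun i => continuous_comp_sphere (hc i) r
  have h2 := fun i => continuous_radialDeriv (hu i) r
  rw [almgrenH_eq_sphereIntegral hc hr]
  have hdisc : ∀ t : ℝ, 0 ≤ sphereIntegral (fun x => ∑ i, u i x ^ 2) r * (t * t) +
      2 * radialFlux u r * t + radialEnergy u r := by
    intro t
    have hcomm : ∀ a b c : ℝ, a * (t * t) + 2 * b * t + c = t * t * a + 2 * t * b + c :=
      fun a b c => by ring
    rw [hcomm, sphereIntegral, radialFlux, radialEnergy,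
      ← integral_const_mul, ← integral_const_mul, ← integral_add, ← integral_add]
    · refine integral_nonneg fun ω => ?_
      rw [Finset.mul_sum, Finset.mul_sum, ← Finset.sum_add_distrib, ← Finset.sum_add_distrib]
      refine Finset.sum_nonneg fun i _ => ?_
      nlinarith [sq_nonneg (t * u i (r • (ω : RSpace N)) +
        inner ℝ (ω : RSpace N) (gradient (u i) (r • (ω : RSpace N))))]
    all_goals exact integrable_toSphere (by fun_prop)
  have := discrim_le_zero hdisc
  rw [discrim] at this
  linarith

lemma almgrenE_nonneg (hN : 1 ≤ N) {r : ℝ} (hr : 0 < r) : 0 ≤ almgrenE u 0 r := by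
  rw [almgrenE_eq hN hr]
  have : 0 ≤ ∫ x in Metric.ball (0 : RSpace N) r, energyDensity u x :=
    integral_nonneg (energyDensity_nonneg u)
  positivity

lemma scaledInteraction_nonneg {r : ℝ} (hr : 0 < r) : 0 ≤ scaledInteraction u r := by
  have : 0 ≤ ∫ x in Metric.ball (0 : RSpace N) r, interactionDensity u x :=
    integral_nonneg (interactionDensity_nonneg u)
  unfold scaledInteraction
  positivity

/-- The height is positive beyond some radius: it is nondecreasing and does not vanish at a radius
`|x|` with `uᵢ(x) ≠ 0`. -/
lemma exists_almgrenH_pos (hN : 1 ≤ N) (hu : IsNonnegSolution u) :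
    ∃ r₀, 0 < r₀ ∧ ∀ r, r₀ ≤ r → 0 < almgrenH u 0 r := by
  have : Nontrivial (RSpace N) := Module.nontrivial_of_finrank_pos (R := ℝ) (by simp; omega)
  have hc : ∀ i, Continuous (u i) := fun i => (hu.contDiff i).continuous
  obtain ⟨i, -, -, ⟨x₁, hx₁⟩, -⟩ := hu.two_nontrivial
  obtain ⟨x, hx0, hx⟩ := (dense_compl_singleton (0 : RSpace N)).exists_mem_open
    (isOpen_ne_fun (hc i) continuous_const) ⟨x₁, hx₁⟩
  have hx : u i x ≠ 0 := hx
  have hx0 : x ≠ 0 := hx0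
  have hpos : 0 < ‖x‖ := norm_pos_iff.2 hx0
  refine ⟨‖x‖, hpos, fun r hr => ?_⟩
  have hmono : MonotoneOn (almgrenH u 0) (Set.Ioi 0) := by
    refine monotoneOn_of_deriv_nonneg (convex_Ioi _) (fun s hs => ?_) (fun s hs => ?_)
      (fun s hs => ?_)
    · exact (hasDerivAt_almgrenH hu.contDiff hs).continuousAt.continuousWithinAt
    · exact (hasDerivAt_almgrenH hu.contDiff
        (interior_subset hs)).differentiableAt.differentiableWithinAt
    · have hs : 0 < s := interior_subset hs
      rw [(hasDerivAt_almgrenH hu.contDiff hs).deriv]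
      have h1 := mul_radialFlux_eq hN hu hs
      have h2 := almgrenE_nonneg (u := u) hN hs
      have h3 := scaledInteraction_nonneg (u := u) hs
      have : 0 ≤ s * radialFlux u s := by linarith
      linarith [nonneg_of_mul_nonneg_right this hs]
  refine lt_of_lt_of_le ?_ (hmono hpos (hpos.trans_le hr) hr)
  rw [almgrenH_eq_sphereIntegral hc hpos, sphereIntegral]
  have hcont : Continuous fun x => ∑ i, u i x ^ 2 := by fun_prop
  refine (continuous_comp_sphere hcont ‖x‖).integral_pos_of_hasCompactSupport_nonneg_nonzero
    (HasCompactSupport.of_compactSpace _) (fun ω => Finset.sum_nonneg fun i _ => sq_nonneg _)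
    (x := ⟨‖x‖⁻¹ • x, by simp [norm_smul, hpos.ne']⟩) ?_
  have hxx : ‖x‖ • (‖x‖⁻¹ • x) = x := by rw [smul_smul, mul_inv_cancel₀ hpos.ne', one_smul]
  simp only [hxx]
  exact (Finset.sum_pos' (fun j _ => sq_nonneg (u j x))
    ⟨i, Finset.mem_univ _, by positivity⟩).ne'

/-- Two nontrivial components cannot both be constant without interacting. -/
lemma exists_energyDensity_pos (hu : IsNonnegSolution u) : ∃ x, 0 < energyDensity u x := by
  by_contra! hle
  have hsplit : ∀ x, energyDensity u x =
    ∑ i, ‖gradient (u i) x‖ ^ 2 + interactionDensity u x := fun x => rfl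
  have hgrad : ∀ i x, gradient (u i) x = 0 := fun i x => by
    have h1 : ‖gradient (u i) x‖ ^ 2 ≤ ∑ i, ‖gradient (u i) x‖ ^ 2 :=
      Finset.single_le_sum (f := fun i => ‖gradient (u i) x‖ ^ 2)
        (fun j _ => sq_nonneg _) (Finset.mem_univ i)
    have h2 := hle x
    rw [hsplit] at h2
    have h3 := interactionDensity_nonneg u x
    have h4 : ‖gradient (u i) x‖ ^ 2 ≤ 0 := by linarith
    simpa using le_antisymm h4 (sq_nonneg _)
  have hconst : ∀ i x y, u i x = u i y := fun i =>
    is_const_of_fderiv_eq_zero ((hu.contDiff i).differentiable two_ne_zero) fun x => by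
      rw [← toDual_gradient, hgrad, map_zero]
  obtain ⟨i, j, hij, ⟨x, hx⟩, ⟨y, hy⟩⟩ := hu.two_nontrivial
  rw [hconst j y x] at hy
  wlog hlt : i < j generalizing i j
  · exact this j i hij.symm hy hx (lt_of_le_of_ne (not_lt.1 hlt) hij.symm)
  have hWpos : 0 < interactionDensity u x :=
    Finset.sum_pos' (fun _ _ => by positivity) ⟨i, Finset.mem_univ _,
      Finset.sum_pos' (fun _ _ => by positivity) ⟨j, Finset.mem_Ioi.2 hlt, by positivity⟩⟩
  have h2 := hle x
  rw [hsplit] at h2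
  have : 0 ≤ ∑ i, ‖gradient (u i) x‖ ^ 2 := by positivity
  linarith

lemma exists_almgrenE_pos (hN : 1 ≤ N) (hu : IsNonnegSolution u) (r₀ : ℝ) :
    ∃ r, r₀ ≤ r ∧ 0 < almgrenE u 0 r := by
  obtain ⟨x, hx⟩ := exists_energyDensity_pos hu
  have he := (contDiff_energyDensity hu.contDiff).continuous
  obtain ⟨r, hr₀, hr⟩ : ∃ r, r₀ ≤ r ∧ ‖x‖ < r :=
    ⟨max r₀ (‖x‖ + 1), le_max_left _ _, (lt_add_one _).trans_le (le_max_right _ _)⟩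
  have hr0 : 0 < r := (norm_nonneg x).trans_lt hr
  refine ⟨r, hr₀, ?_⟩
  rw [almgrenE_eq hN hr0]
  have : 0 < ∫ x in Metric.ball (0 : RSpace N) r, energyDensity u x := by
    have hint : IntegrableOn (energyDensity u) (Metric.ball (0 : RSpace N) r) :=
      (he.continuousOn.integrableOn_compact (isCompact_closedBall 0 r)).mono_set
        Metric.ball_subset_closedBall
    rw [setIntegral_pos_iff_support_of_nonneg_ae (.of_forall fun y => energyDensity_nonneg u y)
      hint]
    have hopen : IsOpen (Function.support (energyDensity u) ∩ Metric.ball (0 : RSpace N) r) :=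
      he.isOpen_support.inter Metric.isOpen_ball
    exact hopen.measure_pos volume ⟨x, hx.ne', mem_ball_zero_iff.2 hr⟩
  exact div_pos (mul_pos hr0 this) (pow_pos hr0 _)

lemma exists_almgrenH_le (hu : IsNonnegSolution u) (hg : HasAlgebraicGrowth u) :
    ∃ M p : ℝ, ∀ r, 1 ≤ r → almgrenH u 0 r ≤ M * r ^ (2 * p) := by
  obtain ⟨C, p, hC, hp, hle⟩ := hg
  have hc : ∀ i, Continuous (u i) := fun i => (hu.contDiff i).continuous
  refine ⟨(volume : Measure (RSpace N)).toSphere.real Set.univ * (4 * C ^ 2), p, fun r hr => ?_⟩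
  have hr0 : 0 < r := one_pos.trans_le hr
  have hcont : Continuous fun x => ∑ i, u i x ^ 2 := by fun_prop
  rw [almgrenH_eq_sphereIntegral hc hr0, sphereIntegral]
  calc
    _ ≤ ∫ _ : Metric.sphere (0 : RSpace N) 1, 4 * C ^ 2 * r ^ (2 * p)
        ∂(volume : Measure (RSpace N)).toSphere := by
      refine integral_mono (integrable_toSphere (continuous_comp_sphere hcont r))
        (integrable_const _) fun ω => ?_
      have h1 : (1 : ℝ) ≤ r ^ p := Real.one_le_rpow hr hp.le
      have h2 := hle (r • (ω : RSpace N))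
      have h3 : ‖r • (ω : RSpace N)‖ = r := by simp [norm_smul, abs_of_pos hr0]
      rw [h3] at h2
      have h4 : ∑ i, u i (r • (ω : RSpace N)) ≤ C * (2 * r ^ p) := h2.trans (by gcongr; linarith)
      have h5 : 0 ≤ ∑ i, u i (r • (ω : RSpace N)) := Finset.sum_nonneg fun i _ => hu.nonneg i _
      calc
        ∑ i, u i (r • (ω : RSpace N)) ^ 2 ≤ (∑ i, u i (r • (ω : RSpace N))) ^ 2 :=
          Finset.sum_sq_le_sq_sum_of_nonneg fun i _ => hu.nonneg i _
        _ ≤ (C * (2 * r ^ p)) ^ 2 := by gcongr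
        _ = 4 * C ^ 2 * r ^ (2 * p) := by
          rw [two_mul p, Real.rpow_add hr0]
          ring
    _ = _ := by simp [mul_assoc]

theorem exists_frequencySystem (hN : 1 ≤ N) (hu : IsNonnegSolution u) :
    ∃ r₀, FrequencySystem (almgrenH u 0) (almgrenE u 0) (radialFlux u) (radialEnergy u)
      (scaledInteraction u) r₀ := by
  obtain ⟨r₀, hr₀, hpos⟩ := exists_almgrenH_pos hN hu
  exact ⟨r₀, hr₀, fun _ => hasDerivAt_almgrenH hu.contDiff, fun _ => hasDerivAt_almgrenE hN hu,
    fun _ => mul_radialFlux_eq hN hu, fun _ => radialFlux_sq_le hu.contDiff,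
    fun _ => scaledInteraction_nonneg, fun _ => almgrenE_nonneg hN, hpos⟩

end Solution

theorem proposition1p5 (N k : ℕ) (hN : 1 ≤ N) (u : Fin k → RSpace N → ℝ)
    (hu : IsNonnegSolution u) (hgrowth : HasAlgebraicGrowth u) :
    ∃ d : ℝ, Tendsto (fun r : ℝ => almgrenFrequency u 0 r) atTop (𝓝 d) ∧ 0 < d ∧
      HasGrowthRate u d := by
  obtain ⟨r₀, S⟩ := exists_frequencySystem hN hu
  obtain ⟨M, p, hM⟩ := exists_almgrenH_le hu hgrowth
  exact S.exists_limit_and_growth hM (exists_almgrenE_pos hN hu r₀)
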